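/- Scalars are real or complex throughout. Completely regular spaces are understood to be Hausdorff. For a completely regular space $X$ let $\beta X$ be its Stone–Čech compactification; every continuous $f:X\to\mathbb R$ extends continuously to $\beta X$ with values in $\mathbb R\cup\{\infty\}$, the one-point compactification of $\mathbb R$. The space $X$ is called realcompact if every $p\in\beta X$ at which the extension of every continuous $f:X\to\mathbb R$ is finite belongs to $X$. For a normed space $E$ (not necessarily complete), $C_b(X,E)$ is the space of bounded continuous functions $X\to E$ with the sup norm. A linear map $T:C_b(X,E)\to C_b(Y,F)$ is separating if $\|f(x)\|\,\|g(x)\|=0$ for all $x\in X$ implies $\|(Tf)(y)\|\,\|(Tg)(y)\|=0$ for all $y\in Y$; it is biseparating if moreover $T$ is bijective and $T^{-1}$ is separating. **Theorem 3.1.** (a) Let $X,Y$ be completely regular realcompact spaces and $E,F$ normed spaces, and suppose that $Y$ has no isolated points. Then every linear biseparating map $T:C_b(X,E)\to C_b(Y,F)$ is continuous. (b) Conversely, let $X$ be a completely regular space with an isolated point $x_0$, and let $E$ be a normed space. If $J_0:E\to E$ is a discontinuous linear bijection, then $$(Tf)(x)=\begin{cases} f(x), & x\neq x_0,\\ J_0(f(x_0)),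 & x=x_0,\end{cases}$$ defines a discontinuous linear biseparating map $T:C_b(X,E)\to C_b(X,E)$. In particular, whenever $X$ has an isolated point and $E$ is infinite-dimensional, there is a discontinuous linear biseparating map $C_b(X,E)\to C_b(X,E)$. -/

import Mathlib

open scoped BoundedContinuousFunction Topology

/-- The continuous extension of a real-valued continuous function on `X` to the Stone-Čech
compactification of `X`; at points outside `X` its value may be infinite, so it is valued in the
one-point compactification of `ℝ`. -/
noncomputable def betaExtension {X : Type*} [TopologicalSpace X] (f : C(X, ℝ)) :
    StoneCech X → OnePoint ℝ :=
  stoneCechExtend (OnePoint.continuous_coe.comp f.continuous)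

/-- The realcompactification of `X`: the points of the Stone-Čech compactification at which the
extension of every real-valued continuous function on `X` is finite. -/
def realcompactification (X : Type*) [TopologicalSpace X] : Set (StoneCech X) :=
  {p | ∀ f : C(X, ℝ), betaExtension f p ≠ OnePoint.infty}

/-- `X` is realcompact if its realcompactification has no points other than those of `X`. -/
def IsRealcompact (X : Type*) [TopologicalSpace X] : Prop :=
  realcompactification X ⊆ Set.range (stoneCechUnit : X → StoneCech X)

/-- A linear map between spaces of bounded continuous functions is separating if it maps any two
functions with disjoint cozero sets to functions with disjoint cozero sets. -/
def IsSeparating {𝕜 X Y E F : Type*} [RCLike 𝕜] [TopologicalSpace X] [TopologicalSpace Y]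
    [NormedAddCommGroup E] [NormedSpace 𝕜 E] [NormedAddCommGroup F] [NormedSpace 𝕜 F]
    (T : (X →ᵇ E) →ₗ[𝕜] (Y →ᵇ F)) : Prop :=
  ∀ f g : X →ᵇ E, (∀ x, ‖f x‖ * ‖g x‖ = 0) → ∀ y, ‖T f y‖ * ‖T g y‖ = 0

/-- A linear map is biseparating if it is separating and has an inverse which is separating. -/
def IsBiseparating {𝕜 X Y E F : Type*} [RCLike 𝕜] [TopologicalSpace X] [TopologicalSpace Y]
    [NormedAddCommGroup E] [NormedSpace 𝕜 E] [NormedAddCommGroup F] [NormedSpace 𝕜 F]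
    (T : (X →ᵇ E) →ₗ[𝕜] (Y →ᵇ F)) : Prop :=
  IsSeparating T ∧ ∃ S : (Y →ᵇ F) →ₗ[𝕜] (X →ᵇ E),
    (∀ f, S (T f) = f) ∧ (∀ g, T (S g) = g) ∧ IsSeparating S

/-! ### Disjoint open sets in the absence of isolated points -/

section Topology

/-! If `T` were discontinuous, the open sets `O n` where some `f` in the unit ball has `‖T f y‖ > (n
+ 1)²` would all be nonempty. Without isolated points they contain pairwise disjoint nonempty open
sets `V n`. Cut-offs `φ n` leave `T (f n)` unchanged at a point `y n ∈ V n` and confine the image to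
`V n` (`IsSeparating.exists_cutoff`). As the inverse is separating, the `φ n • f n` have disjoint
cozero sets and glue with weights `1 / (n + 1)` to a bounded `g`. Then `‖T g (y n)‖ > n + 1` for
every `n`, which is absurd. At an isolated point the value can be altered independently of all
others, so any discontinuous linear bijection of `E` is admissible there. -/

/-- In a Hausdorff space without isolated points, a decreasing sequence of nonempty open sets
contains a sequence of pairwise disjoint nonempty open sets. -/
theorem exists_pairwise_disjoint_open_subset {Y : Type*} [TopologicalSpace Y] [T2Space Y]
    (hY : ∀ y : Y, ¬ IsOpen ({y} : Set Y)) {O : ℕ → Set Y} (hO : ∀ n, IsOpen (O n))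
    (hne : ∀ n, (O n).Nonempty) (hanti : Antitone O) :
    ∃ V : ℕ → Set Y, (∀ n, IsOpen (V n)) ∧ (∀ n, (V n).Nonempty) ∧ (∀ n, V n ⊆ O n) ∧
      Pairwise (Function.onFun Disjoint V) := by
  -- Invariant: the remaining set `W` meets every `O m`. Two disjoint open pieces of `W ∩ O n`
  -- exist. If the first meets every `O m`, it is kept and the second becomes `V`. Otherwise it
  -- misses some `O m₀`, hence so does its closure, and removing that closure preserves the
  -- invariant.
  have step : ∀ (W : {W : Set Y // IsOpen W ∧ ∀ m, (W ∩ O m).Nonempty}) (n : ℕ),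
      ∃ (V : Set Y) (W' : {W : Set Y // IsOpen W ∧ ∀ m, (W ∩ O m).Nonempty}),
        IsOpen V ∧ V.Nonempty ∧ V ⊆ W.1 ∧ V ⊆ O n ∧ W'.1 ⊆ W.1 ∧ Disjoint V W'.1 := by
    rintro ⟨W, hW, hWO⟩ n
    have hU : IsOpen (W ∩ O n) := hW.inter (hO n)
    obtain ⟨a, ha⟩ := hWO n
    obtain ⟨b, hb, hab⟩ : ∃ b ∈ W ∩ O n, b ≠ a := by
      by_contra! h
      exact hY a (by rwa [Set.eq_singleton_iff_unique_mem.2 ⟨ha, h⟩] at hU)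
    obtain ⟨A, B, hA, hB, haA, hbB, hAB⟩ := t2_separation hab.symm
    by_cases h : ∀ m, ((A ∩ (W ∩ O n)) ∩ O m).Nonempty
    · exact ⟨B ∩ (W ∩ O n), ⟨A ∩ (W ∩ O n), hA.inter hU, h⟩, hB.inter hU, ⟨b, hbB, hb⟩,
        fun x hx => hx.2.1, fun x hx => hx.2.2, fun x hx => hx.2.1,
        hAB.symm.mono Set.inter_subset_left Set.inter_subset_left⟩
    · push Not at h
      obtain ⟨m₀, hm₀⟩ := h
      refine ⟨A ∩ (W ∩ O n), ⟨W \ closure (A ∩ (W ∩ O n)), hW.sdiff isClosed_closure, ?_⟩,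
        hA.inter hU, ⟨a, haA, ha⟩, fun x hx => hx.2.1, fun x hx => hx.2.2, Set.sdiff_subset,
        Set.disjoint_sdiff_right.mono_left subset_closure⟩
      intro m
      obtain ⟨x, hxW, hxO⟩ := hWO (max m m₀)
      have hdisj : Disjoint (A ∩ (W ∩ O n)) (O m₀) := Set.disjoint_iff_inter_eq_empty.2 hm₀
      refine ⟨x, ⟨hxW, fun hx => ?_⟩, hanti (le_max_left m m₀) hxO⟩
      exact Set.disjoint_left.1 (hdisj.closure_left (hO m₀)) hx (hanti (le_max_right m m₀) hxO)
  choose V W' hVo hVne hVW hVO hW'W hdisj using step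
  let s : ℕ → {W : Set Y // IsOpen W ∧ ∀ m, (W ∩ O m).Nonempty} := fun n =>
    Nat.rec ⟨Set.univ, isOpen_univ, fun m => by simpa using hne m⟩ (fun k W => W' W k) n
  have hs : Antitone fun n => (s n).1 := antitone_nat_of_succ_le fun n => hW'W (s n) n
  refine ⟨fun n => V (s n) n, fun n => hVo _ _, fun n => hVne _ _, fun n => hVO _ _, ?_⟩
  refine (pairwise_disjoint_on _).2 fun i j hij => ?_
  exact (hdisj (s i) i).mono_right ((hVW (s j) j).trans (hs (Nat.succ_le_of_lt hij)))

end Topology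

/-! ### Gluing, cut-offs and automatic continuity -/

section BoundedFunctions

variable {𝕜 X Y E F : Type*} [RCLike 𝕜] [TopologicalSpace X] [TopologicalSpace Y]
  [NormedAddCommGroup E] [NormedSpace 𝕜 E] [NormedAddCommGroup F] [NormedSpace 𝕜 F]

/-- Bounded functions with pairwise disjoint cozero sets can be summed with weights tending to
zero, even if the codomain is not complete. -/
theorem BoundedContinuousFunction.exists_eq_smul_of_disjoint (h : ℕ → X →ᵇ E)
    (hle : ∀ n x, ‖h n x‖ ≤ 1) (hdisj : ∀ m n, m ≠ n → ∀ x, h m x = 0 ∨ h n x = 0) :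
    ∃ f : X →ᵇ E, ∀ n x, h n x ≠ 0 → f x = ((n + 1 : 𝕜)⁻¹) • h n x := by
  classical
  have hcle : ∀ n : ℕ, ‖((n + 1 : 𝕜)⁻¹)‖ = 1 / ((n : ℝ) + 1) := fun n => by
    rw [norm_inv, one_div, ← Nat.cast_succ, RCLike.norm_natCast, Nat.cast_succ]
  let f : X → E := fun x =>
    if hx : ∃ n, h n x ≠ 0 then ((hx.choose + 1 : 𝕜)⁻¹) • h hx.choose x else 0
  have hf : ∀ n x, h n x ≠ 0 → f x = ((n + 1 : 𝕜)⁻¹) • h n x := fun n x hn => by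
    have hx : ∃ n, h n x ≠ 0 := ⟨n, hn⟩
    have : hx.choose = n := by
      by_contra hne
      exact (hdisj _ _ hne x).elim hx.choose_spec hn
    simp only [f, dif_pos hx, this]
  have hf0 : ∀ x, (∀ n, h n x = 0) → f x = 0 := fun x hx => dif_neg (by simpa using hx)
  have hcont : Continuous f := by
    refine continuous_of_uniform_approx_of_continuous fun u hu => ?_
    obtain ⟨ε, hε, hεu⟩ := Metric.mem_uniformity_dist.1 hu
    obtain ⟨N, hN⟩ := exists_nat_one_div_lt hε
    -- At each point at most one term is nonzero, so the tail is at most `1 / (N + 1)` uniformly.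
    refine ⟨fun x => ∑ n ∈ Finset.range N, ((n + 1 : 𝕜)⁻¹) • h n x, by fun_prop, fun x => hεu ?_⟩
    beta_reduce
    by_cases hx : ∃ n, h n x ≠ 0
    · obtain ⟨k, hk⟩ := hx
      have hz : ∀ n, n ≠ k → ((n + 1 : 𝕜)⁻¹) • h n x = 0 := fun n hn => by
        rw [(hdisj n k hn x).resolve_right hk, smul_zero]
      rw [hf k x hk]
      by_cases hkN : k < N
      · rw [Finset.sum_eq_single_of_mem k (Finset.mem_range.2 hkN) fun n _ hn => hz n hn, dist_self]
        exact hε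
      · rw [Finset.sum_eq_zero fun n hn => hz n fun hnk => hkN (hnk ▸ Finset.mem_range.1 hn),
          dist_zero_right, norm_smul, hcle]
        calc 1 / ((k : ℝ) + 1) * ‖h k x‖ ≤ 1 / ((k : ℝ) + 1) * 1 := by gcongr; exact hle k x
          _ = 1 / ((k : ℝ) + 1) := mul_one _
          _ ≤ 1 / ((N : ℝ) + 1) := by gcongr; exact_mod_cast not_lt.1 hkN
          _ < ε := hN
    · push Not at hx
      simpa [hf0 x hx, hx] using hε
  refine ⟨.ofNormedAddCommGroup f hcont 1 fun x => ?_, hf⟩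
  by_cases hx : ∃ n, h n x ≠ 0
  · obtain ⟨k, hk⟩ := hx
    rw [hf k x hk, norm_smul, hcle]
    refine mul_le_one₀ ?_ (norm_nonneg _) (hle k x)
    rw [div_le_one (by positivity)]
    exact le_add_of_nonneg_left k.cast_nonneg
  · push Not at hx
    simp [hf0 x hx]

theorem IsSeparating.eq_zero_or_eq_zero {T : (X →ᵇ E) →ₗ[𝕜] (Y →ᵇ F)} (hT : IsSeparating T)
    {f g : X →ᵇ E} (h : ∀ x, f x = 0 ∨ g x = 0) (y : Y) : T f y = 0 ∨ T g y = 0 := by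
  simpa using hT f g (fun x => by simpa using h x) y

/-- A linear bijection with separating inverse maps functions with completely separated cozero
sets to functions with completely separated cozero sets. -/
theorem IsSeparating.exists_separating_function [Nontrivial E]
    {T : (X →ᵇ E) →ₗ[𝕜] (Y →ᵇ F)} {S : (Y →ᵇ F) →ₗ[𝕜] (X →ᵇ E)} (hST : ∀ f, S (T f) = f)
    (hS : IsSeparating S) {a b : Y →ᵇ F} {χ : Y →ᵇ 𝕜} (ha : ∀ y, a y ≠ 0 → χ y = 1)
    (hb : ∀ y, b y ≠ 0 → χ y = 0) :
    ∃ φ : X →ᵇ 𝕜, (∀ x, ‖φ x‖ ≤ 1) ∧ (∀ x, S a x ≠ 0 → φ x = 1) ∧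
      (∀ x, S b x ≠ 0 → φ x = 0) := by
  obtain ⟨e, he⟩ := exists_ne (0 : E)
  set w : Y →ᵇ F := T (.const X e) with hw
  -- The constant `e` splits into two summands: the first vanishes where `S b ≠ 0`, the second where
  -- `S a ≠ 0`. The truncated norm of the first is the required `φ`.
  have hsum : S (χ • w) + S ((1 - χ) • w) = .const X e := by
    rw [← map_add, ← add_smul, add_sub_cancel, one_smul, hw, hST]
  have h0 : ∀ x, S b x ≠ 0 → S (χ • w) x = 0 := fun x hx =>
    (hS.eq_zero_or_eq_zero (f := χ • w) (g := b) (fun y => by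
      by_cases hy : b y = 0
      · exact .inr hy
      · left
        change χ y • w y = 0
        rw [hb y hy, zero_smul]) x).resolve_right hx
  have h1 : ∀ x, S a x ≠ 0 → S (χ • w) x = e := fun x hx => by
    have := (hS.eq_zero_or_eq_zero (f := (1 - χ) • w) (g := a) (fun y => by
      by_cases hy : a y = 0
      · exact .inr hy
      · left
        change (1 - χ y) • w y = 0
        rw [ha y hy, sub_self, zero_smul]) x).resolve_right hx
    simpa [this] using DFunLike.congr_fun hsum x
  have hle : ∀ x, ‖((min 1 (‖S (χ • w) x‖ / ‖e‖) : ℝ) : 𝕜)‖ ≤ 1 := fun x => by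
    rw [RCLike.norm_ofReal, abs_of_nonneg (by positivity)]
    exact min_le_left _ _
  refine ⟨.ofNormedAddCommGroup (fun x => ((min 1 (‖S (χ • w) x‖ / ‖e‖) : ℝ) : 𝕜))
    (RCLike.continuous_ofReal.comp (by fun_prop)) 1 hle, hle, fun x hx => ?_, fun x hx => ?_⟩
  · simp [h1 x hx, norm_ne_zero_iff.2 he]
  · simp [h0 x hx]

/-- The value of `T f` at `y` is not changed by multiplying `f` with a suitable cut-off function
`φ`, which can be chosen such that `T (φ • f)` vanishes outside a given neighbourhood of `y`. -/
theorem IsSeparating.exists_cutoff [CompletelyRegularSpace Y] [Nontrivial E] [Nontrivial F]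
    {T : (X →ᵇ E) →ₗ[𝕜] (Y →ᵇ F)} {S : (Y →ᵇ F) →ₗ[𝕜] (X →ᵇ E)} (hT : IsSeparating T)
    (hST : ∀ f, S (T f) = f) (hTS : ∀ g, T (S g) = g) (hS : IsSeparating S)
    {V : Set Y} (hV : IsOpen V) {y : Y} (hy : y ∈ V) :
    ∃ φ : X →ᵇ 𝕜, (∀ x, ‖φ x‖ ≤ 1) ∧
      ∀ f : X →ᵇ E, T (φ • f) y = T f y ∧ ∀ z ∉ V, T (φ • f) z = 0 := by
  obtain ⟨u', hu', hu'y, hu'V⟩ :=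
    CompletelyRegularSpace.completely_regular y Vᶜ hV.isClosed_compl (by simpa using hy)
  obtain ⟨u, hu, h01, huy, huV⟩ : ∃ u : Y → ℝ, Continuous u ∧ (∀ z, 0 ≤ u z ∧ u z ≤ 1) ∧
      u y = 0 ∧ ∀ z ∉ V, u z = 1 :=
    ⟨fun z => u' z, by fun_prop, fun z => (u' z).2, by simp [hu'y], fun z hz => by
      simp [hu'V (show z ∈ Vᶜ from hz)]⟩
  obtain ⟨v, hv⟩ := exists_ne (0 : F)
  have cutoff : ∀ r : Y → ℝ, Continuous r → (∀ z, 0 ≤ r z ∧ r z ≤ 1) →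
      ∃ ρ : Y →ᵇ 𝕜, ∀ z, ρ z = (r z : 𝕜) := fun r hr hr1 =>
    ⟨.ofNormedAddCommGroup (fun z => (r z : 𝕜)) (RCLike.continuous_ofReal.comp hr) 1 fun z => by
      rw [RCLike.norm_ofReal, abs_of_nonneg (hr1 z).1]; exact (hr1 z).2, fun z => rfl⟩
  -- `α` lives on `u < 1/3`, around `y`; `β` lives on `u > 2/3`, which contains the complement of
  -- `V`; `χ` interpolates from 1 to 0 between them.
  obtain ⟨α, hα⟩ := cutoff (fun z => max 0 (1 / 3 - u z)) (by fun_prop) fun z =>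
    ⟨le_max_left _ _, max_le zero_le_one (by linarith [(h01 z).1])⟩
  obtain ⟨β, hβ⟩ := cutoff (fun z => max 0 (u z - 2 / 3)) (by fun_prop) fun z =>
    ⟨le_max_left _ _, max_le zero_le_one (by linarith [(h01 z).2])⟩
  obtain ⟨χ, hχ⟩ := cutoff (fun z => max 0 (min 1 (2 - 3 * u z))) (by fun_prop) fun z =>
    ⟨le_max_left _ _, max_le zero_le_one (min_le_left _ _)⟩
  obtain ⟨φ, hφ, hφa, hφb⟩ := IsSeparating.exists_separating_function (T := T) hST hS
    (a := α • .const Y v) (b := β • .const Y v) (χ := χ)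
    (fun z hz => by
      have : u z < 1 / 3 := by
        by_contra! h
        refine hz ?_
        change α z • v = 0
        rw [hα, max_eq_left (by linarith)]; simp
      rw [hχ, min_eq_left (by linarith)]; simp)
    (fun z hz => by
      have : 2 / 3 < u z := by
        by_contra! h
        refine hz ?_
        change β z • v = 0
        rw [hβ, max_eq_left (by linarith)]; simp
      rw [hχ, max_eq_left ((min_le_right _ _).trans (by linarith))]; simp)
  refine ⟨φ, hφ, fun f => ⟨?_, fun z hz => ?_⟩⟩
  · have key := hT.eq_zero_or_eq_zero (f := (1 - φ) • f) (g := S (α • .const Y v)) (fun x => by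
      by_cases hx : S (α • .const Y v) x = 0
      · exact .inr hx
      · left
        change (1 - φ x) • f x = 0
        rw [hφa x hx, sub_self, zero_smul]) y
    rw [hTS] at key
    have hne : (α • BoundedContinuousFunction.const Y v) y ≠ 0 := by
      change α y • v ≠ 0
      refine smul_ne_zero ?_ hv
      rw [hα, huy, max_eq_right (by norm_num)]
      exact_mod_cast (by norm_num : (1 / 3 - 0 : ℝ) ≠ 0)
    have := key.resolve_right hne
    rw [sub_smul, one_smul, map_sub, BoundedContinuousFunction.sub_apply, sub_eq_zero] at this
    exact this.symm
  · have key := hT.eq_zero_or_eq_zero (f := φ • f) (g := S (β • .const Y v)) (fun x => by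
      by_cases hx : S (β • .const Y v) x = 0
      · exact .inr hx
      · left
        change φ x • f x = 0
        rw [hφb x hx, zero_smul]) z
    rw [hTS] at key
    refine key.resolve_right ?_
    change β z • v ≠ 0
    refine smul_ne_zero ?_ hv
    rw [hβ, huV z hz, max_eq_right (by norm_num)]
    exact_mod_cast (by norm_num : (1 - 2 / 3 : ℝ) ≠ 0)

theorem LinearMap.exists_norm_le_one_lt_norm_of_not_continuous {T : E →ₗ[𝕜] F}
    (hT : ¬ Continuous T) (C : ℝ) : ∃ f : E, ‖f‖ ≤ 1 ∧ C < ‖T f‖ := by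
  by_contra! h
  refine hT (AddMonoidHomClass.continuous_of_bound T C fun f => ?_)
  rcases eq_or_ne f 0 with rfl | hf
  · simp
  have hf' : 0 < ‖f‖ := norm_pos_iff.2 hf
  have := h ((‖f‖⁻¹ : 𝕜) • f) (norm_smul_inv_norm hf).le
  rw [map_smul, norm_smul, norm_inv, RCLike.norm_ofReal, abs_of_pos hf', inv_mul_le_iff₀ hf']
    at this
  linarith

/-- Automatic continuity of biseparating maps. -/
theorem IsBiseparating.continuous [T35Space Y] (hY : ∀ y : Y, ¬ IsOpen ({y} : Set Y))
    {T : (X →ᵇ E) →ₗ[𝕜] (Y →ᵇ F)} (hT : IsBiseparating T) : Continuous T := by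
  obtain ⟨hsep, S, hST, hTS, hS⟩ := hT
  rcases subsingleton_or_nontrivial E with hE | hE
  · have : Subsingleton (X →ᵇ E) := ⟨fun f g => by ext x; exact Subsingleton.elim _ _⟩
    exact continuous_of_const fun f g => by rw [Subsingleton.elim f g]
  rcases subsingleton_or_nontrivial F with hF | hF
  · exact continuous_of_const fun f g => by ext y; exact Subsingleton.elim _ _
  by_contra hcont
  -- The square leaves a factor `n + 1` after division by the weight `n + 1`.
  let O : ℕ → Set Y := fun n => {y | ∃ f : X →ᵇ E, ‖f‖ ≤ 1 ∧ ((n : ℝ) + 1) ^ 2 < ‖T f y‖}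
  have hO : ∀ n, IsOpen (O n) := fun n => by
    simp only [O, Set.ofPred_exists, Set.ofPred_and]
    exact isOpen_iUnion fun f => isOpen_const.inter
      (isOpen_lt continuous_const (T f).continuous.norm)
  have hne : ∀ n, (O n).Nonempty := fun n => by
    obtain ⟨f, hf, hlt⟩ :=
      LinearMap.exists_norm_le_one_lt_norm_of_not_continuous hcont (((n : ℝ) + 1) ^ 2)
    by_contra! h
    refine hlt.not_ge ((BoundedContinuousFunction.norm_le (by positivity)).2 fun y => ?_)
    by_contra! hy
    exact Set.notMem_empty y (h ▸ ⟨f, hf, hy⟩)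
  have hanti : Antitone O := by
    rintro m n hmn y ⟨f, hf, hlt⟩
    refine ⟨f, hf, lt_of_le_of_lt ?_ hlt⟩
    gcongr
  obtain ⟨V, hVo, hVne, hVO, hVd⟩ := exists_pairwise_disjoint_open_subset hY hO hne hanti
  choose y hy using hVne
  choose f hf hlt using fun n => hVO n (hy n)
  choose φ hφ hcut using fun n =>
    IsSeparating.exists_cutoff (𝕜 := 𝕜) hsep hST hTS hS (hVo n) (hy n)
  have hdisj : ∀ m n, m ≠ n → ∀ x, (φ m • f m) x = 0 ∨ (φ n • f n) x = 0 := fun m n hmn x => by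
    have := hS.eq_zero_or_eq_zero (f := T (φ m • f m)) (g := T (φ n • f n)) (fun z => by
      by_cases hz : z ∈ V m
      · exact .inr ((hcut n (f n)).2 z (Set.disjoint_left.1 (hVd hmn) hz))
      · exact .inl ((hcut m (f m)).2 z hz)) x
    rwa [hST, hST] at this
  obtain ⟨g, hg⟩ := BoundedContinuousFunction.exists_eq_smul_of_disjoint (𝕜 := 𝕜)
    (fun n => φ n • f n) (fun n x => by
      change ‖φ n x • f n x‖ ≤ 1
      rw [norm_smul]
      exact mul_le_one₀ (hφ n x) (norm_nonneg _) (((f n).norm_coe_le_norm x).trans (hf n))) hdisj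
  obtain ⟨n, hn⟩ := exists_nat_gt ‖T g‖
  have hpos : (0 : ℝ) < (n : ℝ) + 1 := by positivity
  have hTn : T (φ n • f n) (y n) = T (f n) (y n) := (hcut n (f n)).1
  have hval : T g (y n) = ((n + 1 : 𝕜)⁻¹) • T (f n) (y n) := by
    -- `g` agrees with its `n`th term wherever that term is nonzero, and the image of that term is
    -- nonzero at `y n`.
    have := (hsep.eq_zero_or_eq_zero (f := g - ((n + 1 : 𝕜)⁻¹) • (φ n • f n)) (g := φ n • f n)
      (fun x => by
        by_cases hx : (φ n • f n) x = 0
        · exact .inr hx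
        · left
          rw [BoundedContinuousFunction.sub_apply, BoundedContinuousFunction.smul_apply,
            hg n x hx, sub_self]) (y n)).resolve_right (by
        rw [hTn]
        exact norm_pos_iff.1 (lt_trans (by positivity) (hlt n)))
    rw [map_sub, map_smul, BoundedContinuousFunction.sub_apply,
      BoundedContinuousFunction.smul_apply, hTn, sub_eq_zero] at this
    exact this
  have hle : ‖T g (y n)‖ ≤ ‖T g‖ := (T g).norm_coe_le_norm _
  rw [hval, norm_smul, norm_inv, ← Nat.cast_succ, RCLike.norm_natCast, Nat.cast_succ,
    inv_mul_le_iff₀ hpos] at hle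
  nlinarith [hlt n]

/-! ### Discontinuous examples at an isolated point -/

/-- Apply a linear map to the value of a bounded continuous function at an isolated point. -/
noncomputable def BoundedContinuousFunction.mapAtIsolated {x₀ : X} (hx₀ : IsOpen ({x₀} : Set X))
    [T1Space X] (J : E →ₗ[𝕜] E) : (X →ᵇ E) →ₗ[𝕜] (X →ᵇ E) :=
  haveI := Classical.decEq X
  { toFun := fun f => .ofNormedAddCommGroup (Function.update f x₀ (J (f x₀)))
      (by
        refine continuous_iff_continuousAt.2 fun x => ?_
        by_cases hx : x = x₀
        · subst hx
          rw [ContinuousAt, (isOpen_singleton_iff_nhds_eq_pure x).1 hx₀]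
          exact tendsto_pure_nhds _ _
        · refine f.continuous.continuousAt.congr ?_
          filter_upwards [isOpen_compl_singleton.mem_nhds hx] with z hz
          exact (Function.update_of_ne hz _ _).symm)
      (max ‖f‖ ‖J (f x₀)‖)
      (fun x => by
        by_cases hx : x = x₀
        · subst hx; simp
        · rw [Function.update_of_ne hx]
          exact (f.norm_coe_le_norm x).trans (le_max_left _ _))
    map_add' := fun f g => by
      ext x
      by_cases hx : x = x₀
      · subst hx; simp
      · simp [hx]
    map_smul' := fun c f => by
      ext x
      by_cases hx : x = x₀
      · subst hx; simp
      · simp [hx] }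

section MapAtIsolated

variable [T1Space X] {x₀ : X} (hx₀ : IsOpen ({x₀} : Set X))

theorem BoundedContinuousFunction.mapAtIsolated_apply_self (J : E →ₗ[𝕜] E) (f : X →ᵇ E) :
    mapAtIsolated hx₀ J f x₀ = J (f x₀) := by
  simp [mapAtIsolated]

theorem BoundedContinuousFunction.mapAtIsolated_apply_of_ne (J : E →ₗ[𝕜] E) (f : X →ᵇ E) {x : X}
    (hx : x ≠ x₀) : mapAtIsolated hx₀ J f x = f x := by
  simp [mapAtIsolated, hx]

open BoundedContinuousFunction

theorem isSeparating_mapAtIsolated (J : E →ₗ[𝕜] E) : IsSeparating (mapAtIsolated hx₀ J) := by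
  intro f g h x
  have hx := h x
  by_cases hxx : x = x₀
  · subst hxx
    rw [mapAtIsolated_apply_self, mapAtIsolated_apply_self]
    rcases mul_eq_zero.1 hx with h0 | h0 <;> simp [norm_eq_zero.1 h0]
  · rwa [mapAtIsolated_apply_of_ne hx₀ J f hxx, mapAtIsolated_apply_of_ne hx₀ J g hxx]

theorem mapAtIsolated_leftInverse {J K : E →ₗ[𝕜] E} (h : ∀ e, K (J e) = e) (f : X →ᵇ E) :
    mapAtIsolated hx₀ K (mapAtIsolated hx₀ J f) = f := by
  ext x
  by_cases hx : x = x₀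
  · subst hx
    rw [mapAtIsolated_apply_self, mapAtIsolated_apply_self, h]
  · rw [mapAtIsolated_apply_of_ne hx₀ _ _ hx, mapAtIsolated_apply_of_ne hx₀ _ _ hx]

theorem isBiseparating_mapAtIsolated (J : E ≃ₗ[𝕜] E) :
    IsBiseparating (mapAtIsolated hx₀ (J : E →ₗ[𝕜] E)) :=
  ⟨isSeparating_mapAtIsolated hx₀ _, mapAtIsolated hx₀ (J.symm : E →ₗ[𝕜] E),
    mapAtIsolated_leftInverse hx₀ (by simp), mapAtIsolated_leftInverse hx₀ (by simp),
    isSeparating_mapAtIsolated hx₀ _⟩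

/-- `J` factors as the embedding of constants, then the map, then evaluation at `x₀`. -/
theorem continuous_of_continuous_mapAtIsolated {J : E →ₗ[𝕜] E}
    (h : Continuous (mapAtIsolated hx₀ J)) : Continuous J := by
  have hconst : Continuous (BoundedContinuousFunction.const X : E → X →ᵇ E) :=
    (LipschitzWith.of_dist_le_mul (K := 1) fun a b => by
      simpa using (BoundedContinuousFunction.dist_le dist_nonneg).2 fun _ => le_rfl).continuous
  have := ((BoundedContinuousFunction.lipschitz_eval_const (β := E) x₀).continuous).comp (h.comp hconst)
  refine this.congr fun e => ?_
  simp [mapAtIsolated_apply_self]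

end MapAtIsolated

variable (𝕜 E) in
/-- An infinite-dimensional normed space has a discontinuous linear automorphism. -/
theorem exists_linearEquiv_not_continuous (hE : ¬ FiniteDimensional 𝕜 E) :
    ∃ J : E ≃ₗ[𝕜] E, ¬ Continuous J := by
  classical
  let b := Module.Basis.ofVectorSpace 𝕜 E
  have hinf : Infinite (Module.Basis.ofVectorSpaceIndex 𝕜 E) := by
    by_contra h
    have : Finite (Module.Basis.ofVectorSpaceIndex 𝕜 E) := not_infinite_iff_finite.1 h
    exact hE (Module.Finite.of_basis b)
  let i := Infinite.natEmbedding (Module.Basis.ofVectorSpaceIndex 𝕜 E)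
  -- Off the range of `i` the value of `Function.invFun` is arbitrary; adding 1 keeps every weight
  -- nonzero.
  let w : Module.Basis.ofVectorSpaceIndex 𝕜 E → 𝕜ˣ := fun j =>
    Units.mk0 ((Function.invFun i j + 1 : ℕ) : 𝕜) (Nat.cast_ne_zero.2 (Nat.succ_ne_zero _))
  let J : E ≃ₗ[𝕜] E := b.equiv (b.unitsSMul w) (Equiv.refl _)
  have hJ : ∀ n, J (b (i n)) = ((n + 1 : ℕ) : 𝕜) • b (i n) := fun n => by
    simp only [J, Module.Basis.equiv_apply, Equiv.refl_apply, Module.Basis.unitsSMul_apply, w,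
      Function.leftInverse_invFun i.injective n, Units.smul_def, Units.val_mk0]
  refine ⟨J, fun hcont => ?_⟩
  let L : E →L[𝕜] E := ⟨J, hcont⟩
  obtain ⟨n, hn⟩ := exists_nat_gt ‖L‖
  have h := L.le_opNorm (b (i n))
  change ‖J (b (i n))‖ ≤ _ at h
  rw [hJ, norm_smul, RCLike.norm_natCast] at h
  have := le_of_mul_le_mul_right h (norm_pos_iff.2 (b.ne_zero _))
  push_cast at this
  linarith

end BoundedFunctions

theorem theorem3p1 {𝕜 X Y E F : Type*} [RCLike 𝕜]
    [TopologicalSpace X] [T35Space X] [TopologicalSpace Y] [T35Space Y]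
    [NormedAddCommGroup E] [NormedSpace 𝕜 E] [NormedAddCommGroup F] [NormedSpace 𝕜 F] :
    -- automatic continuity
    (IsRealcompact X → IsRealcompact Y → (∀ y : Y, ¬ IsOpen ({y} : Set Y)) →
      ∀ T : (X →ᵇ E) →ₗ[𝕜] (Y →ᵇ F), IsBiseparating T → Continuous T) ∧
    -- an isolated point and a discontinuous linear bijection give a discontinuous example
    (∀ x₀ : X, IsOpen ({x₀} : Set X) → ∀ J₀ : E ≃ₗ[𝕜] E, ¬ Continuous J₀ →
      ∃ T : (X →ᵇ E) →ₗ[𝕜] (X →ᵇ E),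
        (∀ f x, x ≠ x₀ → T f x = f x) ∧ (∀ f, T f x₀ = J₀ (f x₀)) ∧
        IsBiseparating T ∧ ¬ Continuous T) ∧
    -- hence one exists as soon as there is an isolated point and `E` is infinite-dimensional
    ((∃ x₀ : X, IsOpen ({x₀} : Set X)) → ¬ FiniteDimensional 𝕜 E →
      ∃ T : (X →ᵇ E) →ₗ[𝕜] (X →ᵇ E), IsBiseparating T ∧ ¬ Continuous T) := by
  refine ⟨fun _ _ hY T hT => hT.continuous hY, fun x₀ hx₀ J₀ hJ₀ => ?_, ?_⟩
  · exact ⟨BoundedContinuousFunction.mapAtIsolated hx₀ (J₀ : E →ₗ[𝕜] E),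
      fun f x hx => BoundedContinuousFunction.mapAtIsolated_apply_of_ne hx₀ _ f hx,
      fun f => BoundedContinuousFunction.mapAtIsolated_apply_self hx₀ _ f,
      isBiseparating_mapAtIsolated hx₀ J₀,
      fun h => hJ₀ (continuous_of_continuous_mapAtIsolated hx₀ h)⟩
  · rintro ⟨x₀, hx₀⟩ hE
    obtain ⟨J, hJ⟩ := exists_linearEquiv_not_continuous 𝕜 E hE
    exact ⟨_, isBiseparating_mapAtIsolated hx₀ J,
      fun h => hJ (continuous_of_continuous_mapAtIsolated hx₀ h)⟩
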